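/- Let $U\subset\mathbb{R}^4$ be an open set with coordinates $(u,v,x_1,x_2)$, let $H=H(u,x_1,x_2)$ be a smooth function on $U$ that does not depend on $v$, and let \[ g=2\,du\,dv+H(u,x_1,x_2)\,du^2+dx_1^2+dx_2^2 \] be the corresponding $4$-dimensional $pp$-wave metric on $U$. Let $W$ be its Weyl tensor and $\operatorname{div}W$ the divergence of $W$ with respect to the Levi-Civita connection of $g$. Call $(U,g)$ (locally) isotropically conformally Einstein if every point of $U$ has an open neighbourhood $V\subset U$ and a smooth function $f\colon V\to\mathbb{R}$ such that the gradient $\nabla f$ (with respect to $g$) is lightlike at every point of $V$, that is $\nabla f\neq 0$ and $g(\nabla f,\nabla f)=0$, and the conformal metric $e^{-f}g$ is Einstein on $V$, that is its Ricci tensor is a constant multiple of $e^{-f}g$. Then $(U,g)$ is isotropically conformally Einstein if and only if $\operatorname{div}W=0$ on $U$. -/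

import Mathlib

open scoped ContDiff

noncomputable section

namespace PPWave

/-- Points of `ℝ⁴`, with coordinates `(u, v, x₁, x₂) = (p 0, p 1, p 2, p 3)`. -/
abbrev Coord : Type := Fin 4 → ℝ

/-- A field of bilinear forms on `ℝ⁴`, given by its matrix `g p i j = g_p(∂ᵢ, ∂ⱼ)` in the coordinate
frame. All the tensors below are meaningful at the points near which `g` is smooth, symmetric and
nondegenerate. -/
abbrev MetricField : Type := Coord → Matrix (Fin 4) (Fin 4) ℝ

/-- The partial derivative `∂ᵢ F` at `p`. -/
def pderiv (i : Fin 4) (F : Coord → ℝ) (p : Coord) : ℝ :=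
  fderiv ℝ F p (Pi.single i 1)

/-- The Christoffel symbol `Γᵏᵢⱼ` of the Levi-Civita connection, `∇_{∂ᵢ} ∂ⱼ = ∑ₖ Γᵏᵢⱼ ∂ₖ`. -/
def christoffel (g : MetricField) (k i j : Fin 4) (p : Coord) : ℝ :=
  (1 / 2) * ∑ l, (g p)⁻¹ k l *
    (pderiv i (fun q => g q j l) p + pderiv j (fun q => g q i l) p
      - pderiv l (fun q => g q i j) p)

/-- The component along `∂ₗ` of `R(∂ᵢ, ∂ⱼ) ∂ₖ`, where `R(X, Y) = ∇_{[X, Y]} - [∇_X, ∇_Y]`. -/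
def curvatureOp (g : MetricField) (i j k l : Fin 4) (p : Coord) : ℝ :=
  -(pderiv i (christoffel g l j k) p - pderiv j (christoffel g l i k) p
    + ∑ m, (christoffel g l i m p * christoffel g m j k p
      - christoffel g l j m p * christoffel g m i k p))

/-- The curvature tensor `R(X, Y, Z, T) = g(R(X, Y) Z, T)` on `(∂ᵢ, ∂ⱼ, ∂ₖ, ∂ₗ)`. -/
def riemann (g : MetricField) (i j k l : Fin 4) (p : Coord) : ℝ :=
  ∑ m, g p m l * curvatureOp g i j k m p

/-- The Ricci tensor `ρ(∂ᵢ, ∂ⱼ) = ∑ gᵃᵇ R(∂ᵢ, ∂ₐ, ∂ⱼ, ∂_b)`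
(with this sign, `ρ` is positive on round spheres). -/
def ricci (g : MetricField) (i j : Fin 4) (p : Coord) : ℝ :=
  ∑ a, ∑ b, (g p)⁻¹ a b * riemann g i a j b p

/-- The scalar curvature `τ`. -/
def scalar (g : MetricField) (p : Coord) : ℝ :=
  ∑ a, ∑ b, (g p)⁻¹ a b * ricci g a b p

/-- The Weyl tensor in dimension four, on `(∂ᵢ, ∂ⱼ, ∂ₖ, ∂ₗ)`. -/
def weyl (g : MetricField) (i j k l : Fin 4) (p : Coord) : ℝ :=
  riemann g i j k l p
    + scalar g p / 6 * (g p i k * g p j l - g p i l * g p j k)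
    + (1 / 2) * (ricci g i l p * g p j k - ricci g i k p * g p j l
      + ricci g j k p * g p i l - ricci g j l p * g p i k)

/-- The component `(∇_{∂ₐ} W)(∂ᵢ, ∂ⱼ, ∂ₖ, ∂ₗ)` of the covariant derivative of the Weyl tensor. -/
def covWeyl (g : MetricField) (a i j k l : Fin 4) (p : Coord) : ℝ :=
  pderiv a (weyl g i j k l) p
    - ∑ m, (christoffel g m a i p * weyl g m j k l p + christoffel g m a j p * weyl g i m k l p
      + christoffel g m a k p * weyl g i j m l p + christoffel g m a l p * weyl g i j k m p)

/-- The divergence `(div W)(∂ᵢ, ∂ⱼ, ∂ₖ) = ∑ gᵃᵇ (∇_{∂ₐ} W)(∂ᵢ, ∂ⱼ, ∂ₖ, ∂_b)`. -/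
def divWeyl (g : MetricField) (i j k : Fin 4) (p : Coord) : ℝ :=
  ∑ a, ∑ b, (g p)⁻¹ a b * covWeyl g a i j k b p

/-- `div W = 0` on `U`. -/
def HasHarmonicWeylOn (g : MetricField) (U : Set Coord) : Prop :=
  ∀ p ∈ U, ∀ i j k, divWeyl g i j k p = 0

/-- `g` is Einstein on `V`: `ρ = Λ g` with a constant `Λ`. -/
def IsEinsteinOn (g : MetricField) (V : Set Coord) : Prop :=
  ∃ Λ : ℝ, ∀ p ∈ V, ∀ i j, ricci g i j p = Λ * g p i j

/-- The gradient `∇f` with respect to `g`, as a vector of components. -/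
def gradient (g : MetricField) (f : Coord → ℝ) (p : Coord) : Fin 4 → ℝ :=
  fun i => ∑ j, (g p)⁻¹ i j * pderiv j f p

/-- The vector `X` at `p` is lightlike: nonzero and null. -/
def IsLightlike (g : MetricField) (p : Coord) (X : Fin 4 → ℝ) : Prop :=
  X ≠ 0 ∧ ∑ i, ∑ j, g p i j * X i * X j = 0

/-- The conformal metric `e^{-f} g`. -/
def conformal (f : Coord → ℝ) (g : MetricField) : MetricField :=
  fun p => Real.exp (-f p) • g p

/-- `g` is (locally) isotropically conformally Einstein on `U`: every point of `U` has an open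
neighbourhood `V ⊆ U` with a smooth function `f` on `V` whose gradient is lightlike everywhere
and for which `e^{-f} g` is Einstein. -/
def IsIsotropicallyConformallyEinsteinOn (g : MetricField) (U : Set Coord) : Prop :=
  ∀ p ∈ U, ∃ V : Set Coord, IsOpen V ∧ p ∈ V ∧ V ⊆ U ∧
    ∃ f : Coord → ℝ, ContDiffOn ℝ ∞ f V ∧
      (∀ q ∈ V, IsLightlike g q (gradient g f q)) ∧
      IsEinsteinOn (conformal f g) V

/-- The metric `2 du dv + H du² + dx₁² + dx₂²`. -/
def ppMetric (H : Coord → ℝ) : MetricField :=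
  fun p => !![H p, 1, 0, 0;
              1,   0, 0, 0;
              0,   0, 1, 0;
              0,   0, 0, 1]

/-- `H` is on `U` a smooth function of `(u, x₁, x₂)` only, so that `ppMetric H` is a pp-wave
on `U`. -/
structure IsPPProfileOn (H : Coord → ℝ) (U : Set Coord) : Prop where
  smooth : ContDiffOn ℝ ∞ H U
  indep : ∀ p ∈ U, ∀ q ∈ U, p 0 = q 0 → p 2 = q 2 → p 3 = q 3 → H p = H q

end PPWave

end

open Filter Topology

noncomputable section

namespace PPWave

/-! Write `L = ∂₂²H + ∂₃²H` for the transverse Laplacian. A pp-wave has Ricci tensor `-½ L du²` and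
zero scalar curvature, and its Weyl tensor is built from the trace-free transverse Hessian of `H`.
The divergence of that Hessian is half the transverse differential of `L`, so `div W = 0` means
exactly `∂₂L = ∂₃L = 0` (`hasHarmonicWeylOn_ppMetric_iff`).

In dimension four `e^{-f} g` has Ricci tensor `ρ + Hess f + ½ df² + ½ (Δf - |df|²) g`
(`ricci_conformal`). If `L` depends on `u` alone, take `f = F(u)`: its gradient `F' ∂ᵥ` is null, and
the Einstein equation with constant `0` becomes the ODE `F'' = L/2 - F'²/2`, solved locally with `F'
≠ 0`.

Conversely, for a null `f` the Einstein equation reads `Hess f = μ g + ½ L du² - ½ df²`.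
Differentiating `|df|² = 0` gives `Hess f(∇f, ·) = 0`, which forces `μ = 0` and `L ∂ᵥf = 0`. Where
`∂ᵥf ≠ 0`, differentiating `L ∂ᵥf = 0` kills `∂₂L` and `∂₃L`; where `∂ᵥf = 0`, the symmetry of third
derivatives of `f` does (`pderiv_transverseLaplacian_eq_zero`). -/

/-! ### Calculus of partial derivatives on open sets. -/

theorem pderiv_congr {F G : Coord → ℝ} {U : Set Coord} (hU : IsOpen U) (h : ∀ q ∈ U, F q = G q)
    {p : Coord} (hp : p ∈ U) (i : Fin 4) : pderiv i F p = pderiv i G p := by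
  unfold pderiv
  rw [Filter.EventuallyEq.fderiv_eq (Filter.eventuallyEq_of_mem (hU.mem_nhds hp) h)]

@[simp] theorem pderiv_const (i : Fin 4) (c : ℝ) (p : Coord) : pderiv i (fun _ => c) p = 0 := by
  simp [pderiv]

theorem pderiv_eq_zero {F : Coord → ℝ} {U : Set Coord} (hU : IsOpen U) (h : ∀ q ∈ U, F q = 0)
    {p : Coord} (hp : p ∈ U) (i : Fin 4) : pderiv i F p = 0 := by
  rw [pderiv_congr hU h hp i, pderiv_const]

section Rules

variable {F G : Coord → ℝ} {p : Coord} (i : Fin 4)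

theorem pderiv_add (hF : DifferentiableAt ℝ F p) (hG : DifferentiableAt ℝ G p) :
    pderiv i (fun q => F q + G q) p = pderiv i F p + pderiv i G p := by
  simp [pderiv, fderiv_fun_add hF hG]

theorem pderiv_sub (hF : DifferentiableAt ℝ F p) (hG : DifferentiableAt ℝ G p) :
    pderiv i (fun q => F q - G q) p = pderiv i F p - pderiv i G p := by
  simp [pderiv, fderiv_fun_sub hF hG]

theorem pderiv_mul (hF : DifferentiableAt ℝ F p) (hG : DifferentiableAt ℝ G p) :
    pderiv i (fun q => F q * G q) p = pderiv i F p * G p + F p * pderiv i G p := by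
  simp [pderiv, fderiv_fun_mul hF hG]; ring

theorem pderiv_const_mul (c : ℝ) (hF : DifferentiableAt ℝ F p) :
    pderiv i (fun q => c * F q) p = c * pderiv i F p := by
  simp [pderiv, fderiv_const_mul hF]

theorem pderiv_sq (hF : DifferentiableAt ℝ F p) :
    pderiv i (fun q => F q ^ 2) p = 2 * F p * pderiv i F p := by
  simp only [pow_two]
  rw [pderiv_mul i hF hF]; ring

theorem pderiv_exp_neg (hF : DifferentiableAt ℝ F p) :
    pderiv i (fun q => Real.exp (-F q)) p = -(Real.exp (-F p) * pderiv i F p) := by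
  have : HasFDerivAt (fun q => Real.exp (-F q)) (Real.exp (-F p) • -fderiv ℝ F p) p :=
    hF.hasFDerivAt.neg.exp
  simp [pderiv, this.fderiv]

end Rules

theorem contDiffOn_pderiv {F : Coord → ℝ} {U : Set Coord} (hF : ContDiffOn ℝ ∞ F U)
    (hU : IsOpen U) (i : Fin 4) : ContDiffOn ℝ ∞ (pderiv i F) U :=
  (hF.fderiv_of_isOpen hU (by simp)).clm_apply contDiffOn_const

theorem differentiableAt_of_contDiffOn {F : Coord → ℝ} {U : Set Coord}
    (hF : ContDiffOn ℝ ∞ F U) (hU : IsOpen U) {p : Coord} (hp : p ∈ U) : DifferentiableAt ℝ F p :=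
  (hF.contDiffAt (hU.mem_nhds hp)).differentiableAt (by simp)

theorem pderiv_comm {F : Coord → ℝ} {U : Set Coord} (hF : ContDiffOn ℝ ∞ F U)
    (hU : IsOpen U) {p : Coord} (hp : p ∈ U) (i j : Fin 4) :
    pderiv i (pderiv j F) p = pderiv j (pderiv i F) p := by
  have hc : ContDiffAt ℝ ∞ F p := hF.contDiffAt (hU.mem_nhds hp)
  have hs : IsSymmSndFDerivAt ℝ F p := hc.isSymmSndFDerivAt (by
    rw [minSmoothness_of_isRCLikeNormedField]; exact WithTop.coe_le_coe.2 (le_top : (2 : ℕ∞) ≤ ⊤))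
  have hd : DifferentiableAt ℝ (fderiv ℝ F) p :=
    (hc.fderiv_right (m := 1) (by norm_cast)).differentiableAt (by simp)
  have key : ∀ a b : Fin 4, pderiv a (pderiv b F) p
      = fderiv ℝ (fderiv ℝ F) p (Pi.single a 1) (Pi.single b 1) := by
    intro a b
    have : HasFDerivAt (pderiv b F)
        ((ContinuousLinearMap.apply ℝ ℝ (Pi.single b 1 : Coord)).comp (fderiv ℝ (fderiv ℝ F) p)) p :=
      (ContinuousLinearMap.apply ℝ ℝ (Pi.single b 1 : Coord)).hasFDerivAt.comp p hd.hasFDerivAt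
    rw [pderiv, this.fderiv]; rfl
  rw [key, key]; exact hs _ _

/-- Near `p` the line in direction `∂ᵥ` stays in the open set `U`, and `H` is constant along it. -/
theorem IsPPProfileOn.pderiv_one {H : Coord → ℝ} {U : Set Coord} (hH : IsPPProfileOn H U)
    (hU : IsOpen U) {p : Coord} (hp : p ∈ U) : pderiv 1 H p = 0 := by
  have hd := differentiableAt_of_contDiffOn hH.smooth hU hp
  have hline : HasLineDerivAt ℝ H (fderiv ℝ H p (Pi.single 1 1)) p (Pi.single 1 1) :=
    hd.hasFDerivAt.hasLineDerivAt _
  have hev : (fun t : ℝ => H (p + t • Pi.single 1 1)) =ᶠ[𝓝 0] fun _ => H p := by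
    have hc : ContinuousAt (fun t : ℝ => p + t • (Pi.single 1 1 : Coord)) 0 := by fun_prop
    have := hc.preimage_mem_nhds (by simpa using hU.mem_nhds hp)
    filter_upwards [this] with t ht
    exact hH.indep _ ht _ hp (by simp) (by simp) (by simp)
  have h0 : HasDerivAt (fun t : ℝ => H (p + t • Pi.single 1 1)) 0 0 :=
    (hasDerivAt_const (0 : ℝ) (H p)).congr_of_eventuallyEq hev
  exact HasDerivAt.unique hline h0

/-! ### Matrix algebra of the metric and of its conformal changes. -/

theorem ppMetric_inv (H : Coord → ℝ) (p : Coord) :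
    (ppMetric H p)⁻¹ = !![0, 1, 0, 0; 1, -H p, 0, 0; 0, 0, 1, 0; 0, 0, 0, 1] := by
  apply Matrix.inv_eq_right_inv
  ext i j
  fin_cases i <;> fin_cases j <;>
    simp [ppMetric, Matrix.mul_apply, Fin.sum_univ_four]

theorem ppMetric_isUnit_det (H : Coord → ℝ) (p : Coord) : IsUnit (ppMetric H p).det := by
  apply Matrix.isUnit_det_of_right_inverse
    (B := !![0, 1, 0, 0; 1, -H p, 0, 0; 0, 0, 1, 0; 0, 0, 0, 1])
  ext i j
  fin_cases i <;> fin_cases j <;>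
    simp [ppMetric, Matrix.mul_apply, Fin.sum_univ_four]

theorem ppMetric_isSymm (H : Coord → ℝ) (p : Coord) : (ppMetric H p).IsSymm := by
  ext i j
  fin_cases i <;> fin_cases j <;> simp [ppMetric]

theorem conformal_inv (f : Coord → ℝ) (g : MetricField) {p : Coord} (hg : IsUnit (g p).det) :
    (conformal f g p)⁻¹ = Real.exp (f p) • (g p)⁻¹ := by
  apply Matrix.inv_eq_right_inv
  rw [conformal, Matrix.smul_mul, Matrix.mul_smul, Matrix.mul_nonsing_inv _ hg, smul_smul,
    ← Real.exp_add]
  simp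

theorem conformal_zero (g : MetricField) : conformal (fun _ => 0) g = g := by
  funext p; simp [conformal]

/-- For a symmetric nondegenerate metric the Ricci tensor is the trace of the curvature operator. -/
theorem ricci_eq_sum_curvatureOp (g : MetricField) {p : Coord} (hg : IsUnit (g p).det)
    (hs : (g p).IsSymm) (i j : Fin 4) :
    ricci g i j p = ∑ a, curvatureOp g i a j a p := by
  unfold ricci riemann
  refine Finset.sum_congr rfl fun a _ => ?_
  have h1 : ∀ m, ∑ b, (g p)⁻¹ a b * g p m b = (1 : Matrix (Fin 4) (Fin 4) ℝ) a m := by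
    intro m
    rw [← Matrix.nonsing_inv_mul _ hg, Matrix.mul_apply]
    exact Finset.sum_congr rfl fun b _ => by rw [hs.apply]
  calc ∑ b, (g p)⁻¹ a b * ∑ m, g p m b * curvatureOp g i a j m p
      = ∑ m, (∑ b, (g p)⁻¹ a b * g p m b) * curvatureOp g i a j m p := by
        simp only [Finset.mul_sum, Finset.sum_mul]
        rw [Finset.sum_comm]
        exact Finset.sum_congr rfl fun _ _ => Finset.sum_congr rfl fun _ _ => by ring
    _ = curvatureOp g i a j a p := by
        simp [h1, Matrix.one_apply]

/-! ### Christoffel symbols and Ricci tensor of a metric conformal to a pp-wave. -/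

/-- The components of `du`. -/
def duForm : Fin 4 → ℝ := ![1, 0, 0, 0]

/-- The components of `∂ᵥ`, the gradient of `u`. -/
def dvVec : Fin 4 → ℝ := ![0, 1, 0, 0]

/-- Raising the index of a covector which vanishes on `∂ᵥ`. -/
def raiseTransverse (h : Fin 4 → ℝ) : Fin 4 → ℝ := ![0, h 0, h 2, h 3]

/-- Raising the index of a covector by the metric with profile value `c`. -/
def raiseIndex (c : ℝ) (w : Fin 4 → ℝ) : Fin 4 → ℝ := ![w 1, w 0 - c * w 1, w 2, w 3]

/-- The Christoffel symbols of a pp-wave as a function of the first derivatives of its profile. -/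
def ppGamma (h : Fin 4 → ℝ) (k i j : Fin 4) : ℝ :=
  (1 / 2) * (dvVec k * (h i * duForm j + h j * duForm i)
    - raiseTransverse h k * (duForm i * duForm j))

/-- The Kronecker symbol. -/
def kron (i j : Fin 4) : ℝ := if i = j then 1 else 0

/-- The Christoffel symbols of the metric conformal to a pp-wave, as a function of the value
`c` and the derivatives `h` of the profile, the matrix `g` of the pp-wave and the derivatives `w`
of the conformal exponent. -/
def confGamma (g : Matrix (Fin 4) (Fin 4) ℝ) (c : ℝ) (h w : Fin 4 → ℝ) (k i j : Fin 4) : ℝ :=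
  ppGamma h k i j - (1 / 2) * (kron k i * w j + kron k j * w i - g i j * raiseIndex c w k)

/-- The derivative of `confGamma` in the direction `∂ₐ`, where `ha` and `wa` are the derivatives of
`h` and `w`. -/
def dconfGamma (g : Matrix (Fin 4) (Fin 4) ℝ) (c : ℝ) (h w : Fin 4 → ℝ) (a : Fin 4)
    (ha wa : Fin 4 → ℝ) (k i j : Fin 4) : ℝ :=
  ppGamma ha k i j - (1 / 2) * (kron k i * wa j + kron k j * wa i
    - (h a * (duForm i * duForm j) * raiseIndex c w k
      + g i j * (raiseIndex c wa k - h a * w 1 * dvVec k)))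

theorem pderiv_ppMetric (H : Coord → ℝ) (a i j : Fin 4) (p : Coord) :
    pderiv a (fun q => ppMetric H q i j) p = pderiv a H p * (duForm i * duForm j) := by
  fin_cases i <;> fin_cases j <;> simp [ppMetric, duForm]

theorem differentiableAt_ppMetric {H : Coord → ℝ} {p : Coord} (hd : DifferentiableAt ℝ H p)
    (i j : Fin 4) : DifferentiableAt ℝ (fun q => ppMetric H q i j) p := by
  fin_cases i <;> fin_cases j <;> simp [ppMetric, hd]

/-- The factor `e^{f}` of the inverse metric cancels the `e^{-f}` of the differentiated metric, so
only first derivatives of `f` survive and the remaining identity is polynomial. -/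
theorem christoffel_conformal {H f : Coord → ℝ} {p : Coord} (hd : DifferentiableAt ℝ H p)
    (hf : DifferentiableAt ℝ f p) (h1 : pderiv 1 H p = 0) (k i j : Fin 4) :
    christoffel (conformal f (ppMetric H)) k i j p
      = confGamma (ppMetric H p) (H p) (fun a => pderiv a H p) (fun a => pderiv a f p) k i j := by
  have hp : ∀ a b c, pderiv a (fun q => conformal f (ppMetric H) q b c) p
      = Real.exp (-f p) * (pderiv a H p * (duForm b * duForm c) - pderiv a f p * ppMetric H p b c) := by
    intro a b c
    have hE : DifferentiableAt ℝ (fun q => Real.exp (-f q)) p := by fun_prop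
    have := pderiv_mul a hE (differentiableAt_ppMetric hd b c)
    simp only [conformal, Matrix.smul_apply, smul_eq_mul]
    rw [this, pderiv_exp_neg a hf, pderiv_ppMetric]; ring
  have hE : ∀ x, Real.exp (f p) * (Real.exp (-f p) * x) = x := by
    intro x; rw [← mul_assoc, ← Real.exp_add]; simp
  unfold christoffel
  simp only [hp, conformal_inv f (ppMetric H) (ppMetric_isUnit_det H p), Matrix.smul_apply,
    smul_eq_mul]
  have : ∀ l, Real.exp (f p) * (ppMetric H p)⁻¹ k l *
      (Real.exp (-f p) * (pderiv i H p * (duForm j * duForm l) - pderiv i f p * ppMetric H p j l)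
      + Real.exp (-f p) * (pderiv j H p * (duForm i * duForm l) - pderiv j f p * ppMetric H p i l)
      - Real.exp (-f p) * (pderiv l H p * (duForm i * duForm j) - pderiv l f p * ppMetric H p i j))
      = (ppMetric H p)⁻¹ k l *
      ((pderiv i H p * (duForm j * duForm l) - pderiv i f p * ppMetric H p j l)
      + (pderiv j H p * (duForm i * duForm l) - pderiv j f p * ppMetric H p i l)
      - (pderiv l H p * (duForm i * duForm j) - pderiv l f p * ppMetric H p i j)) := by
    intro l
    rw [← hE ((ppMetric H p)⁻¹ k l * _)]; ring
  simp only [this]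
  clear this hE hp
  simp only [ppMetric_inv, Fin.sum_univ_four]
  generalize hh : (fun a => pderiv a H p) = h
  generalize hw : (fun a => pderiv a f p) = w
  have eh : ∀ a, pderiv a H p = h a := fun a => congrFun hh a
  have ew : ∀ a, pderiv a f p = w a := fun a => congrFun hw a
  simp only [eh, ew] at h1 ⊢
  simp only [confGamma, ppGamma, kron]
  fin_cases k <;> fin_cases i <;> fin_cases j <;>
    simp [duForm, dvVec, raiseTransverse, raiseIndex, ppMetric, h1] <;> ring

theorem pderiv_ppGamma {h : Fin 4 → Coord → ℝ} {p : Coord} (hd : ∀ a, DifferentiableAt ℝ (h a) p)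
    (a k i j : Fin 4) :
    pderiv a (fun q => ppGamma (fun b => h b q) k i j) p
      = ppGamma (fun b => pderiv a (h b) p) k i j := by
  have hr : DifferentiableAt ℝ (fun q => raiseTransverse (fun b => h b q) k) p := by
    fin_cases k <;> simp [raiseTransverse, hd]
  have hr' : pderiv a (fun q => raiseTransverse (fun b => h b q) k) p
      = raiseTransverse (fun b => pderiv a (h b) p) k := by
    fin_cases k <;> simp [raiseTransverse]
  have e : (fun q => ppGamma (fun b => h b q) k i j) = fun q =>
      (1 / 2) * (dvVec k * (duForm j * h i q + duForm i * h j q)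
        - duForm i * duForm j * raiseTransverse (fun b => h b q) k) := by
    funext q; simp only [ppGamma]; ring
  have hi := hd i
  have hj := hd j
  rw [e, pderiv_const_mul a _ (by fun_prop), pderiv_sub a (by fun_prop) (by fun_prop),
    pderiv_const_mul a _ (by fun_prop), pderiv_const_mul a _ (by fun_prop),
    pderiv_add a (by fun_prop) (by fun_prop), pderiv_const_mul a _ (by fun_prop),
    pderiv_const_mul a _ (by fun_prop), hr', ppGamma]
  ring

theorem differentiableAt_ppGamma {h : Fin 4 → Coord → ℝ} {p : Coord}
    (hd : ∀ a, DifferentiableAt ℝ (h a) p) (k i j : Fin 4) :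
    DifferentiableAt ℝ (fun q => ppGamma (fun b => h b q) k i j) p := by
  have hr : DifferentiableAt ℝ (fun q => raiseTransverse (fun b => h b q) k) p := by
    fin_cases k <;> simp [raiseTransverse, hd]
  have hi := hd i
  have hj := hd j
  unfold ppGamma
  fun_prop

theorem pderiv_confGamma {H : Coord → ℝ} {h w : Fin 4 → Coord → ℝ} {p : Coord}
    (hH : DifferentiableAt ℝ H p) (hd : ∀ a, DifferentiableAt ℝ (h a) p)
    (wd : ∀ a, DifferentiableAt ℝ (w a) p) (a k i j : Fin 4) :
    pderiv a (fun q => confGamma (ppMetric H q) (H q) (fun b => h b q) (fun b => w b q) k i j) p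
      = dconfGamma (ppMetric H p) (H p) (fun b => pderiv b H p) (fun b => w b p) a
          (fun b => pderiv a (h b) p) (fun b => pderiv a (w b) p) k i j := by
  have hG := differentiableAt_ppGamma hd k i j
  have hg := differentiableAt_ppMetric hH i j
  have w0 := wd 0
  have w1 := wd 1
  have hm : DifferentiableAt ℝ (fun q => H q * w 1 q) p := by fun_prop
  have hr : DifferentiableAt ℝ (fun q => raiseIndex (H q) (fun b => w b q) k) p := by
    fin_cases k
    · simpa [raiseIndex] using wd 1
    · simpa [raiseIndex] using w0.fun_sub hm
    · simpa [raiseIndex] using wd 2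
    · simpa [raiseIndex] using wd 3
  have hr' : pderiv a (fun q => raiseIndex (H q) (fun b => w b q) k) p
      = raiseIndex (H p) (fun b => pderiv a (w b) p) k - pderiv a H p * w 1 p * dvVec k := by
    fin_cases k
    · simp [raiseIndex, dvVec]
    · simp [raiseIndex, dvVec]
      rw [pderiv_sub a w0 hm, pderiv_mul a hH w1]
      ring
    · simp [raiseIndex, dvVec]
    · simp [raiseIndex, dvVec]
  have wi := wd i
  have wj := wd j
  unfold confGamma
  rw [pderiv_sub a (by fun_prop) (by fun_prop), pderiv_ppGamma hd,
    pderiv_const_mul a _ (by fun_prop), pderiv_sub a (by fun_prop) (by fun_prop),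
    pderiv_add a (by fun_prop) (by fun_prop), pderiv_const_mul a _ (by fun_prop),
    pderiv_const_mul a _ (by fun_prop), pderiv_mul a hg hr, hr', pderiv_ppMetric, dconfGamma]

/-- The contraction behind the Ricci tensor of a metric conformal to a pp-wave. -/
theorem sum_confGamma (c : ℝ) (g : Matrix (Fin 4) (Fin 4) ℝ)
    (hg : g = !![c, 1, 0, 0; 1, 0, 0, 0; 0, 0, 1, 0; 0, 0, 0, 1])
    (h w : Fin 4 → ℝ) (hh ww : Fin 4 → Fin 4 → ℝ) (h1 : h 1 = 0)
    (hh1 : ∀ a, hh a 1 = 0) (hs : ∀ a b, hh a b = hh b a) (ws : ∀ a b, ww a b = ww b a)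
    (i j : Fin 4) :
    ∑ a, -(dconfGamma g c h w i (hh i) (ww i) a a j - dconfGamma g c h w a (hh a) (ww a) a i j
      + ∑ m, (confGamma g c h w a i m * confGamma g c h w m a j
        - confGamma g c h w a a m * confGamma g c h w m i j))
    = -(1 / 2) * (hh 2 2 + hh 3 3) * (duForm i * duForm j) + ww i j
      - (1 / 2) * (w 1 * (h i * duForm j + h j * duForm i)
        - (h 0 * w 1 + h 2 * w 2 + h 3 * w 3) * (duForm i * duForm j))
      + (1 / 2) * (w i * w j)
      + (1 / 2) * ((2 * ww 0 1 - c * ww 1 1 + ww 2 2 + ww 3 3)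
        - (2 * w 0 * w 1 - c * w 1 ^ 2 + w 2 ^ 2 + w 3 ^ 2)) * g i j := by
  have hh1' : ∀ a, hh 1 a = 0 := fun a => by rw [hs, hh1]
  -- The symmetries are instantiated in one direction only, so that they normalise mixed derivatives
  -- without looping in `simp`.
  have s10 := ws 1 0
  have s20 := ws 2 0
  have s30 := ws 3 0
  have s21 := ws 2 1
  have s31 := ws 3 1
  have s32 := ws 3 2
  have t20 := hs 2 0
  have t30 := hs 3 0
  have t32 := hs 3 2
  subst hg
  simp only [Fin.sum_univ_four]
  simp only [confGamma, dconfGamma, ppGamma, kron]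
  fin_cases i <;> fin_cases j <;>
    simp [duForm, dvVec, raiseTransverse, raiseIndex, h1, hh1, hh1', s10, s20, s30, s21, s31, s32,
      t20, t30, t32] <;> ring

/-- This is `ρ + Hess f + ½ df² + ½ (Δf - |df|²) g` in coordinates: the third summand is the
Christoffel part of `Hess f`. In `Δf` that part drops out because `∂ᵥH = 0`. -/
theorem ricci_conformal {H f : Coord → ℝ} {V : Set Coord} (hV : IsOpen V)
    (hH : IsPPProfileOn H V) (hf : ContDiffOn ℝ ∞ f V) {p : Coord} (hp : p ∈ V) (i j : Fin 4) :
    ricci (conformal f (ppMetric H)) i j p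
    = -(1 / 2) * (pderiv 2 (pderiv 2 H) p + pderiv 3 (pderiv 3 H) p) * (duForm i * duForm j)
      + pderiv i (pderiv j f) p
      - (1 / 2) * (pderiv 1 f p * (pderiv i H p * duForm j + pderiv j H p * duForm i)
        - (pderiv 0 H p * pderiv 1 f p + pderiv 2 H p * pderiv 2 f p
          + pderiv 3 H p * pderiv 3 f p) * (duForm i * duForm j))
      + (1 / 2) * (pderiv i f p * pderiv j f p)
      + (1 / 2) * ((2 * pderiv 0 (pderiv 1 f) p - H p * pderiv 1 (pderiv 1 f) p
          + pderiv 2 (pderiv 2 f) p + pderiv 3 (pderiv 3 f) p)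
        - (2 * pderiv 0 f p * pderiv 1 f p - H p * pderiv 1 f p ^ 2 + pderiv 2 f p ^ 2
          + pderiv 3 f p ^ 2)) * ppMetric H p i j := by
  have hinv : (conformal f (ppMetric H) p)⁻¹ * conformal f (ppMetric H) p = 1 := by
    rw [conformal_inv f _ (ppMetric_isUnit_det H p), conformal, Matrix.smul_mul, Matrix.mul_smul,
      Matrix.nonsing_inv_mul _ (ppMetric_isUnit_det H p), smul_smul, ← Real.exp_add]
    simp
  -- As a trace of the curvature operator, the Ricci tensor involves only Christoffel symbols, which
  -- are free of exponentials.
  rw [ricci_eq_sum_curvatureOp _ (Matrix.isUnit_det_of_left_inverse hinv)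
    ((ppMetric_isSymm H p).smul _)]
  have dH : ∀ q ∈ V, DifferentiableAt ℝ H q := fun q hq =>
    differentiableAt_of_contDiffOn hH.smooth hV hq
  have df : ∀ q ∈ V, DifferentiableAt ℝ f q := fun q hq =>
    differentiableAt_of_contDiffOn hf hV hq
  have hchr : ∀ k i j, ∀ q ∈ V, christoffel (conformal f (ppMetric H)) k i j q
      = confGamma (ppMetric H q) (H q) (fun a => pderiv a H q) (fun a => pderiv a f q) k i j :=
    fun k i j q hq => christoffel_conformal (dH q hq) (df q hq) (hH.pderiv_one hV hq) k i j
  have hdchr : ∀ a k i j, pderiv a (christoffel (conformal f (ppMetric H)) k i j) p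
      = dconfGamma (ppMetric H p) (H p) (fun b => pderiv b H p) (fun b => pderiv b f p) a
          (fun b => pderiv a (pderiv b H) p) (fun b => pderiv a (pderiv b f) p) k i j := by
    intro a k i j
    rw [pderiv_congr hV (hchr k i j) hp a]
    exact pderiv_confGamma (h := fun b => pderiv b H) (w := fun b => pderiv b f) (dH p hp)
      (fun b => differentiableAt_of_contDiffOn (contDiffOn_pderiv hH.smooth hV b) hV hp)
      (fun b => differentiableAt_of_contDiffOn (contDiffOn_pderiv hf hV b) hV hp) a k i j
  simp only [curvatureOp, hdchr, hchr _ _ _ p hp]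
  refine sum_confGamma (H p) (ppMetric H p) rfl (fun a => pderiv a H p) (fun a => pderiv a f p)
    (fun a b => pderiv a (pderiv b H) p) (fun a b => pderiv a (pderiv b f) p)
    (hH.pderiv_one hV hp) (fun a => ?_) (fun a b => pderiv_comm hH.smooth hV hp a b)
    (fun a b => pderiv_comm hf hV hp a b) i j
  exact pderiv_eq_zero hV (fun q hq => hH.pderiv_one hV hq) hp a

theorem IsPPProfileOn.mono {H : Coord → ℝ} {U V : Set Coord} (hH : IsPPProfileOn H U)
    (h : V ⊆ U) : IsPPProfileOn H V :=
  ⟨hH.smooth.mono h, fun p hp q hq => hH.indep p (h hp) q (h hq)⟩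

/-! ### Curvature, Weyl tensor and its divergence for a pp-wave. -/

/-- The transverse Laplacian `∂₂² H + ∂₃² H`. -/
def transverseLaplacian (H : Coord → ℝ) (p : Coord) : ℝ :=
  pderiv 2 (pderiv 2 H) p + pderiv 3 (pderiv 3 H) p

theorem contDiffOn_transverseLaplacian {H : Coord → ℝ} {U : Set Coord}
    (hH : ContDiffOn ℝ ∞ H U) (hU : IsOpen U) : ContDiffOn ℝ ∞ (transverseLaplacian H) U :=
  (contDiffOn_pderiv (contDiffOn_pderiv hH hU 2) hU 2).add
    (contDiffOn_pderiv (contDiffOn_pderiv hH hU 3) hU 3)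

/-- The algebraic curvature tensor `-½ (du ⊗ du) ∧ s` of a pp-wave with profile Hessian `s`. -/
def ppCurv (s : Fin 4 → Fin 4 → ℝ) (i j k l : Fin 4) : ℝ :=
  -(1 / 2) * (duForm i * duForm k * s j l - duForm i * duForm l * s j k
    - duForm j * duForm k * s i l + duForm j * duForm l * s i k)

/-- The metric `dx₁² + dx₂²` on the wave fronts. -/
def transverse (i j : Fin 4) : ℝ := ![0, 0, 1, 1] i * kron i j

theorem pderiv_ppCurv {s : Fin 4 → Fin 4 → Coord → ℝ} {p : Coord}
    (hd : ∀ a b, DifferentiableAt ℝ (s a b) p) (a i j k l : Fin 4) :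
    pderiv a (fun q => ppCurv (fun b c => s b c q) i j k l) p
      = ppCurv (fun b c => pderiv a (s b c) p) i j k l := by
  have h1 := hd j l
  have h2 := hd j k
  have h3 := hd i l
  have h4 := hd i k
  unfold ppCurv
  rw [pderiv_const_mul a _ (by fun_prop), pderiv_add a (by fun_prop) (by fun_prop),
    pderiv_sub a (by fun_prop) (by fun_prop), pderiv_sub a (by fun_prop) (by fun_prop),
    pderiv_const_mul a _ (by fun_prop), pderiv_const_mul a _ (by fun_prop),
    pderiv_const_mul a _ (by fun_prop), pderiv_const_mul a _ (by fun_prop)]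

theorem christoffel_ppMetric {H : Coord → ℝ} {p : Coord} (hd : DifferentiableAt ℝ H p)
    (h1 : pderiv 1 H p = 0) (k i j : Fin 4) :
    christoffel (ppMetric H) k i j p = ppGamma (fun a => pderiv a H p) k i j := by
  have := christoffel_conformal (f := fun _ => 0) hd (differentiableAt_const _) h1 k i j
  rw [conformal_zero] at this
  rw [this]
  have hr : raiseIndex (H p) (fun _ => 0) k = 0 := by fin_cases k <;> simp [raiseIndex]
  simp [confGamma, hr]

theorem duForm_zero : duForm 0 = 1 := rfl
theorem duForm_one : duForm 1 = 0 := rfl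
theorem duForm_two : duForm 2 = 0 := rfl
theorem duForm_three : duForm 3 = 0 := rfl
theorem dvVec_zero : dvVec 0 = 0 := rfl
theorem dvVec_one : dvVec 1 = 1 := rfl
theorem dvVec_two : dvVec 2 = 0 := rfl
theorem dvVec_three : dvVec 3 = 0 := rfl
theorem raiseTransverse_zero (h : Fin 4 → ℝ) : raiseTransverse h 0 = 0 := rfl
theorem raiseTransverse_one (h : Fin 4 → ℝ) : raiseTransverse h 1 = h 0 := rfl
theorem raiseTransverse_two (h : Fin 4 → ℝ) : raiseTransverse h 2 = h 2 := rfl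
theorem raiseTransverse_three (h : Fin 4 → ℝ) : raiseTransverse h 3 = h 3 := rfl

/-- The product is symmetric in `i` and `j`, so the quadratic terms cancel in the curvature, which
is therefore linear in the profile. -/
theorem sum_ppGamma_mul_ppGamma (h : Fin 4 → ℝ) (h1 : h 1 = 0) (m i j k : Fin 4) :
    ∑ n, ppGamma h m i n * ppGamma h n j k
      = -(1 / 4) * dvVec m * (h 2 ^ 2 + h 3 ^ 2) * (duForm i * duForm j * duForm k) := by
  simp only [Fin.sum_univ_four, ppGamma, duForm_zero, duForm_one, duForm_two, duForm_three,
    dvVec_zero, dvVec_one, dvVec_two, dvVec_three, raiseTransverse_zero, raiseTransverse_one,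
    raiseTransverse_two, raiseTransverse_three, h1]
  ring

theorem sum_mul_ppGamma (c : ℝ) (h : Fin 4 → ℝ) (h1 : h 1 = 0) (j k l : Fin 4) :
    ∑ m, (!![c, 1, 0, 0; 1, 0, 0, 0; 0, 0, 1, 0; 0, 0, 0, 1] : Matrix (Fin 4) (Fin 4) ℝ) m l *
      ppGamma h m j k
      = (1 / 2) * (duForm l * (h j * duForm k + h k * duForm j) - h l * (duForm j * duForm k)) := by
  simp only [Fin.sum_univ_four, ppGamma, dvVec_zero, dvVec_one, dvVec_two, dvVec_three,
    raiseTransverse_zero, raiseTransverse_one, raiseTransverse_two, raiseTransverse_three]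
  fin_cases l <;>
    simp [duForm_zero, duForm_one, duForm_two, duForm_three, h1]

/-- The contraction behind the Riemann tensor of a pp-wave. -/
theorem sum_ppGamma (c : ℝ) (h : Fin 4 → ℝ) (s : Fin 4 → Fin 4 → ℝ)
    (h1 : h 1 = 0) (hs1 : ∀ a, s a 1 = 0) (hs : ∀ a b, s a b = s b a) (i j k l : Fin 4) :
    ∑ m, (!![c, 1, 0, 0; 1, 0, 0, 0; 0, 0, 1, 0; 0, 0, 0, 1] : Matrix (Fin 4) (Fin 4) ℝ) m l *
      -(ppGamma (s i) m j k - ppGamma (s j) m i k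
        + ∑ n, (ppGamma h m i n * ppGamma h n j k - ppGamma h m j n * ppGamma h n i k))
      = ppCurv s i j k l := by
  have hq : ∀ m, ∑ n, (ppGamma h m i n * ppGamma h n j k - ppGamma h m j n * ppGamma h n i k)
      = 0 := by
    intro m
    rw [Finset.sum_sub_distrib, sum_ppGamma_mul_ppGamma h h1, sum_ppGamma_mul_ppGamma h h1]
    ring
  simp only [hq, add_zero, neg_sub, mul_sub, Finset.sum_sub_distrib]
  rw [sum_mul_ppGamma c _ (hs1 j), sum_mul_ppGamma c _ (hs1 i), ppCurv, hs j i]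
  ring

section PP

variable {H : Coord → ℝ} {U : Set Coord}

theorem riemann_ppMetric (hU : IsOpen U) (hH : IsPPProfileOn H U) {p : Coord} (hp : p ∈ U)
    (i j k l : Fin 4) :
    riemann (ppMetric H) i j k l p = ppCurv (fun a b => pderiv a (pderiv b H) p) i j k l := by
  have dH : ∀ q ∈ U, DifferentiableAt ℝ H q := fun q hq =>
    differentiableAt_of_contDiffOn hH.smooth hU hq
  have hchr : ∀ k i j, ∀ q ∈ U, christoffel (ppMetric H) k i j q
      = ppGamma (fun a => pderiv a H q) k i j :=
    fun k i j q hq => christoffel_ppMetric (dH q hq) (hH.pderiv_one hU hq) k i j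
  have hdchr : ∀ a k i j, pderiv a (christoffel (ppMetric H) k i j) p
      = ppGamma (fun b => pderiv a (pderiv b H) p) k i j := by
    intro a k i j
    rw [pderiv_congr hU (hchr k i j) hp a]
    exact pderiv_ppGamma (h := fun b => pderiv b H)
      (fun b => differentiableAt_of_contDiffOn (contDiffOn_pderiv hH.smooth hU b) hU hp)
      a k i j
  simp only [riemann, curvatureOp, hdchr, hchr _ _ _ p hp]
  exact sum_ppGamma (H p) (fun a => pderiv a H p) (fun a b => pderiv a (pderiv b H) p)
    (hH.pderiv_one hU hp)
    (fun a => pderiv_eq_zero hU (fun q hq => hH.pderiv_one hU hq) hp a)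
    (fun a b => pderiv_comm hH.smooth hU hp a b) i j k l

theorem ricci_ppMetric (hU : IsOpen U) (hH : IsPPProfileOn H U) {p : Coord} (hp : p ∈ U)
    (i j : Fin 4) :
    ricci (ppMetric H) i j p = -(1 / 2) * transverseLaplacian H p * (duForm i * duForm j) := by
  have := ricci_conformal (f := fun _ => 0) hU hH contDiffOn_const hp i j
  have e : ∀ i, pderiv i (fun _ : Coord => (0 : ℝ)) = fun _ => 0 := fun i => by
    funext q; simp
  rw [conformal_zero] at this
  simpa [e, transverseLaplacian] using this

theorem scalar_ppMetric (hU : IsOpen U) (hH : IsPPProfileOn H U) {p : Coord} (hp : p ∈ U) :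
    scalar (ppMetric H) p = 0 := by
  simp [scalar, ricci_ppMetric hU hH hp, ppMetric_inv, Fin.sum_univ_four, duForm]

/-- With zero scalar curvature, the Ricci correction only removes the transverse trace of the
Hessian of `H`. -/
theorem weyl_ppMetric (hU : IsOpen U) (hH : IsPPProfileOn H U) {p : Coord} (hp : p ∈ U)
    (i j k l : Fin 4) :
    weyl (ppMetric H) i j k l p
      = ppCurv (fun a b => pderiv a (pderiv b H) p - (1 / 2) * transverse a b *
          transverseLaplacian H p) i j k l := by
  simp only [weyl, riemann_ppMetric hU hH hp, scalar_ppMetric hU hH hp, ricci_ppMetric hU hH hp,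
    ppCurv]
  generalize transverseLaplacian H p = L
  -- The terms of `g` outside `dx₁² + dx₂²` contain a factor `du`, and the Kulkarni–Nomizu product
  -- of `du²` with such a term is zero.
  have key : duForm i * duForm k * ppMetric H p j l - duForm i * duForm l * ppMetric H p j k
      - duForm j * duForm k * ppMetric H p i l + duForm j * duForm l * ppMetric H p i k
      = duForm i * duForm k * transverse j l - duForm i * duForm l * transverse j k
      - duForm j * duForm k * transverse i l + duForm j * duForm l * transverse i k := by
    fin_cases i <;> fin_cases j <;> fin_cases k <;> fin_cases l <;>
      simp [duForm, transverse, ppMetric, kron]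
  linear_combination (1 / 4) * L * key

/-- The contraction behind the divergence of the Weyl tensor of a pp-wave. -/
theorem sum_ppCurv (c : ℝ) (h : Fin 4 → ℝ) (m : Fin 4 → Fin 4 → ℝ) (dm : Fin 4 → Fin 4 → Fin 4 → ℝ)
    (hm : ∀ a, m a 1 = 0) (hm' : ∀ a, m 1 a = 0) (hdm : ∀ a b, dm a b 1 = 0)
    (hdm1 : ∀ a b, dm 1 a b = 0) (i j k : Fin 4) :
    ∑ a, ∑ b, (!![0, 1, 0, 0; 1, -c, 0, 0; 0, 0, 1, 0; 0, 0, 0, 1] : Matrix (Fin 4) (Fin 4) ℝ) a b *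
      (ppCurv (dm a) i j k b
        - ∑ n, (ppGamma h n a i * ppCurv m n j k b + ppGamma h n a j * ppCurv m i n k b
          + ppGamma h n a k * ppCurv m i j n b + ppGamma h n a b * ppCurv m i j k n))
      = -(1 / 2) * (duForm k * (duForm i * (dm 2 j 2 + dm 3 j 3)
          - duForm j * (dm 2 i 2 + dm 3 i 3))) := by
  -- All Christoffel terms drop out: an upper index `∂ᵥ` is annihilated by `ppCurv m`, and a factor
  -- `du` in the index `a` is raised to `∂ᵥ` by the contraction. What remains is a flat transverse
  -- divergence.
  simp only [Fin.sum_univ_four]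
  simp [ppGamma, ppCurv, duForm_zero, duForm_one, duForm_two, duForm_three,
    dvVec_zero, dvVec_one, dvVec_two, dvVec_three, raiseTransverse_zero, hm, hm', hdm, hdm1]
  ring

/-- For transverse `j`, the divergence of the Hessian is `∂ⱼL` and the trace correction subtracts `½
∂ⱼL`, which turns the constant `-1/2` of `sum_ppCurv` into `-1/4`. -/
theorem divWeyl_ppMetric (hU : IsOpen U) (hH : IsPPProfileOn H U) {p : Coord} (hp : p ∈ U)
    (i j k : Fin 4) :
    divWeyl (ppMetric H) i j k p
      = -(1 / 4) * (duForm k * (duForm i * pderiv j (transverseLaplacian H) p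
          - duForm j * pderiv i (transverseLaplacian H) p)) := by
  have s1 : ∀ b, ContDiffOn ℝ ∞ (pderiv b H) U := contDiffOn_pderiv hH.smooth hU
  have s2 : ∀ a b, ContDiffOn ℝ ∞ (pderiv a (pderiv b H)) U := fun a b =>
    contDiffOn_pderiv (s1 b) hU a
  have d2 : ∀ a b, DifferentiableAt ℝ (pderiv a (pderiv b H)) p := fun a b =>
    differentiableAt_of_contDiffOn (s2 a b) hU hp
  have dL : DifferentiableAt ℝ (transverseLaplacian H) p :=
    differentiableAt_of_contDiffOn (contDiffOn_transverseLaplacian hH.smooth hU) hU hp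
  have z1 : ∀ q ∈ U, pderiv 1 H q = 0 := fun q hq => hH.pderiv_one hU hq
  have z2 : ∀ a, ∀ q ∈ U, pderiv a (pderiv 1 H) q = 0 := fun a q hq => pderiv_eq_zero hU z1 hq a
  have z2' : ∀ a, ∀ q ∈ U, pderiv 1 (pderiv a H) q = 0 := fun a q hq => by
    rw [pderiv_comm hH.smooth hU hq, z2 a q hq]
  have z3 : ∀ a b, pderiv 1 (pderiv a (pderiv b H)) p = 0 := fun a b => by
    rw [pderiv_comm (s1 b) hU hp]; exact pderiv_eq_zero hU (z2' b) hp a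
  have eL : ∀ a, pderiv a (transverseLaplacian H) p
      = pderiv a (pderiv 2 (pderiv 2 H)) p + pderiv a (pderiv 3 (pderiv 3 H)) p := fun a =>
    pderiv_add a (d2 2 2) (d2 3 3)
  have hdW : ∀ a i j k l, pderiv a (weyl (ppMetric H) i j k l) p
      = ppCurv (fun b c => pderiv a (pderiv b (pderiv c H)) p - (1 / 2) * transverse b c *
          pderiv a (transverseLaplacian H) p) i j k l := by
    intro a i j k l
    rw [pderiv_congr hU (fun q hq => weyl_ppMetric hU hH hq i j k l) hp a]
    rw [pderiv_ppCurv (s := fun b c q => pderiv b (pderiv c H) q - (1 / 2) * transverse b c *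
          transverseLaplacian H q) (fun b c => (d2 b c).fun_sub (dL.const_mul _))]
    congr 1
    funext b c
    rw [pderiv_sub a (d2 b c) (dL.const_mul _), pderiv_const_mul a _ dL]
  have t1 : ∀ a, transverse a 1 = 0 := fun a => by fin_cases a <;> simp [transverse, kron]
  have t1' : ∀ a, transverse 1 a = 0 := fun a => by simp [transverse]
  simp only [divWeyl, covWeyl, hdW, weyl_ppMetric hU hH hp, ppMetric_inv,
    christoffel_ppMetric (differentiableAt_of_contDiffOn hH.smooth hU hp) (z1 p hp)]
  rw [sum_ppCurv (H p) (fun a => pderiv a H p)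
    (fun b c => pderiv b (pderiv c H) p - (1 / 2) * transverse b c * transverseLaplacian H p)
    (fun a b c => pderiv a (pderiv b (pderiv c H)) p - (1 / 2) * transverse b c *
          pderiv a (transverseLaplacian H) p)
    (fun a => by simp [t1, z2 a p hp]) (fun a => by simp [t1', z2' a p hp])
    (fun a b => by simp [t1, pderiv_eq_zero hU (fun q hq => pderiv_eq_zero hU z1 hq b) hp a])
    (fun a b => by simp [eL, z3])]
  have c1 : pderiv 3 (pderiv 2 (pderiv 3 H)) p = pderiv 2 (pderiv 3 (pderiv 3 H)) p :=
    pderiv_comm (s1 3) hU hp 3 2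
  have c2 : pderiv 2 (pderiv 3 (pderiv 2 H)) p = pderiv 3 (pderiv 2 (pderiv 2 H)) p :=
    pderiv_comm (s1 2) hU hp 2 3
  have y1 : ∀ a, pderiv a (pderiv 1 (pderiv a H)) p = 0 := fun a =>
    pderiv_eq_zero hU (z2' a) hp a
  fin_cases i <;> fin_cases j <;> simp [duForm, transverse, kron, eL, c1, c2, y1, z3] <;> ring

theorem IsPPProfileOn.pderiv_one_transverseLaplacian (hH : IsPPProfileOn H U) (hU : IsOpen U)
    {p : Coord} (hp : p ∈ U) : pderiv 1 (transverseLaplacian H) p = 0 := by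
  have s1 : ∀ b, ContDiffOn ℝ ∞ (pderiv b H) U := contDiffOn_pderiv hH.smooth hU
  have hz : ∀ b, pderiv 1 (pderiv b (pderiv b H)) p = 0 := fun b => by
    rw [pderiv_comm (s1 b) hU hp]
    refine pderiv_eq_zero hU (fun q hq => ?_) hp b
    rw [pderiv_comm hH.smooth hU hq]
    exact pderiv_eq_zero hU (fun r hr => hH.pderiv_one hU hr) hq b
  have := pderiv_add (F := pderiv 2 (pderiv 2 H)) (G := pderiv 3 (pderiv 3 H)) (p := p) 1
    (differentiableAt_of_contDiffOn (contDiffOn_pderiv (s1 2) hU 2) hU hp)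
    (differentiableAt_of_contDiffOn (contDiffOn_pderiv (s1 3) hU 3) hU hp)
  rw [hz, hz, add_zero] at this
  exact this

theorem hasHarmonicWeylOn_ppMetric_iff (hU : IsOpen U) (hH : IsPPProfileOn H U) :
    HasHarmonicWeylOn (ppMetric H) U ↔
      ∀ p ∈ U, pderiv 2 (transverseLaplacian H) p = 0 ∧ pderiv 3 (transverseLaplacian H) p = 0 := by
  constructor
  · intro h p hp
    have h2 := h p hp 0 2 0
    have h3 := h p hp 0 3 0
    rw [divWeyl_ppMetric hU hH hp] at h2 h3
    simpa [duForm] using And.intro h2 h3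
  · intro h p hp i j k
    have h1 := hH.pderiv_one_transverseLaplacian hU hp
    rw [divWeyl_ppMetric hU hH hp]
    obtain ⟨h2, h3⟩ := h p hp
    fin_cases i <;> fin_cases j <;> simp [duForm, h1, h2, h3]

end PP

/-! ### Necessity: consequences of a null conformal exponent. -/

theorem pderiv_null_norm {H f0 f1 f2 f3 : Coord → ℝ} {p : Coord} (hH : DifferentiableAt ℝ H p)
    (h0 : DifferentiableAt ℝ f0 p) (h1 : DifferentiableAt ℝ f1 p) (h2 : DifferentiableAt ℝ f2 p)
    (h3 : DifferentiableAt ℝ f3 p) (a : Fin 4) :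
    pderiv a (fun q => 2 * (f0 q * f1 q) - H q * f1 q ^ 2 + f2 q ^ 2 + f3 q ^ 2) p
      = 2 * (pderiv a f0 p * f1 p + f0 p * pderiv a f1 p) - pderiv a H p * f1 p ^ 2
        - 2 * H p * f1 p * pderiv a f1 p + 2 * f2 p * pderiv a f2 p + 2 * f3 p * pderiv a f3 p := by
  rw [pderiv_add a (by fun_prop) (by fun_prop), pderiv_add a (by fun_prop) (by fun_prop),
    pderiv_sub a (by fun_prop) (by fun_prop), pderiv_const_mul a _ (by fun_prop),
    pderiv_mul a h0 h1, pderiv_mul a hH (by fun_prop), pderiv_sq a h1, pderiv_sq a h2,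
    pderiv_sq a h3]
  ring

theorem gradient_ppMetric (H f : Coord → ℝ) (p : Coord) :
    gradient (ppMetric H) f p
      = ![pderiv 1 f p, pderiv 0 f p - H p * pderiv 1 f p, pderiv 2 f p, pderiv 3 f p] := by
  funext i
  fin_cases i <;> simp [gradient, ppMetric_inv, Fin.sum_univ_four] ; ring

theorem isLightlike_gradient_ppMetric_iff (H f : Coord → ℝ) (p : Coord) :
    IsLightlike (ppMetric H) p (gradient (ppMetric H) f p) ↔
      (∃ a, pderiv a f p ≠ 0) ∧
      2 * (pderiv 0 f p * pderiv 1 f p) - H p * pderiv 1 f p ^ 2 + pderiv 2 f p ^ 2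
        + pderiv 3 f p ^ 2 = 0 := by
  rw [IsLightlike, gradient_ppMetric]
  refine and_congr ?_ ?_
  · rw [not_iff_comm]
    push Not
    constructor
    · intro h
      funext i
      fin_cases i <;> simp [h]
    · intro h
      have e0 := congrFun h 0
      have e1 := congrFun h 1
      have e2 := congrFun h 2
      have e3 := congrFun h 3
      simp only [Matrix.cons_val, Pi.zero_apply] at e0 e1 e2 e3
      intro a
      fin_cases a
      · simpa [e0] using e1
      · exact e0
      · exact e2
      · exact e3
  · simp only [Fin.sum_univ_four, ppMetric]
    simp
    constructor <;> intro h <;> linear_combination h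

section

variable {H f : Coord → ℝ} {V : Set Coord}

/-- The Hessian of a null conformal exponent turning a pp-wave into an Einstein metric. -/
theorem exists_hessian_eq (hV : IsOpen V) (hH : IsPPProfileOn H V) (hf : ContDiffOn ℝ ∞ f V)
    (hN : ∀ q ∈ V, 2 * (pderiv 0 f q * pderiv 1 f q) - H q * pderiv 1 f q ^ 2 + pderiv 2 f q ^ 2
        + pderiv 3 f q ^ 2 = 0)
    (hE : IsEinsteinOn (conformal f (ppMetric H)) V) :
    ∃ μ : Coord → ℝ, ∀ q ∈ V, ∀ i j, pderiv i (pderiv j f) q = μ q * ppMetric H q i j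
      + (1 / 2) * transverseLaplacian H q * (duForm i * duForm j)
      + (1 / 2) * (pderiv 1 f q * (pderiv i H q * duForm j + pderiv j H q * duForm i)
        - (pderiv 0 H q * pderiv 1 f q + pderiv 2 H q * pderiv 2 f q
          + pderiv 3 H q * pderiv 3 f q) * (duForm i * duForm j))
      - (1 / 2) * (pderiv i f q * pderiv j f q) := by
  obtain ⟨Λ, hΛ⟩ := hE
  -- `μ = Λ e^{-f} - ½ Δf` collects every multiple of `g`; the `|df|²` term vanishes by nullness.
  refine ⟨fun q => Λ * Real.exp (-f q) - (1 / 2) * (2 * pderiv 0 (pderiv 1 f) q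
    - H q * pderiv 1 (pderiv 1 f) q + pderiv 2 (pderiv 2 f) q + pderiv 3 (pderiv 3 f) q),
    fun q hq i j => ?_⟩
  have h := hΛ q hq i j
  rw [ricci_conformal hV hH hf hq, conformal, Matrix.smul_apply, smul_eq_mul] at h
  rw [transverseLaplacian]
  linear_combination h + (1 / 2) * ppMetric H q i j * hN q hq

/-- For a null conformal exponent the trace part of the Hessian equation vanishes. -/
theorem hessian_trace_eq_zero (hV : IsOpen V) (hH : IsPPProfileOn H V) (hf : ContDiffOn ℝ ∞ f V)
    (hN : ∀ q ∈ V, 2 * (pderiv 0 f q * pderiv 1 f q) - H q * pderiv 1 f q ^ 2 + pderiv 2 f q ^ 2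
        + pderiv 3 f q ^ 2 = 0)
    {μ : ℝ} {q : Coord} (hq : q ∈ V) (hne : ∃ a, pderiv a f q ≠ 0)
    (h : ∀ i j, pderiv i (pderiv j f) q = μ * ppMetric H q i j
      + (1 / 2) * transverseLaplacian H q * (duForm i * duForm j)
      + (1 / 2) * (pderiv 1 f q * (pderiv i H q * duForm j + pderiv j H q * duForm i)
        - (pderiv 0 H q * pderiv 1 f q + pderiv 2 H q * pderiv 2 f q
          + pderiv 3 H q * pderiv 3 f q) * (duForm i * duForm j))
      - (1 / 2) * (pderiv i f q * pderiv j f q)) :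
    μ = 0 ∧ transverseLaplacian H q * pderiv 1 f q = 0 := by
  have d : ∀ a, DifferentiableAt ℝ (pderiv a f) q := fun a =>
    differentiableAt_of_contDiffOn (contDiffOn_pderiv hf hV a) hV hq
  -- Half the derivative of `|df|² = 0` is `Hess f(∇f, ·) = 0`. Inserting the Hessian equation
  -- leaves `μ df + ½ L ∂ᵥf du = 0`, since the `df²` term contributes a multiple of `|df|²`.
  have dN : ∀ a, 2 * μ * pderiv a f q
      + transverseLaplacian H q * pderiv 1 f q * duForm a = 0 := by
    intro a
    have e := pderiv_eq_zero hV hN hq a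
    rw [pderiv_null_norm (differentiableAt_of_contDiffOn hH.smooth hV hq) (d 0) (d 1) (d 2)
      (d 3)] at e
    simp only [h] at e
    have n := hN q hq
    have h1 := hH.pderiv_one hV hq
    fin_cases a <;> simp [ppMetric, duForm, h1] at e <;>
      simp only [Fin.zero_eta, Fin.mk_one, Fin.reduceFinMk, duForm_zero, duForm_one, duForm_two,
        duForm_three] <;>
      linear_combination e + pderiv _ f q * n
  have hμ : μ = 0 := by
    by_contra hμ
    -- Since `du(∂ᵥ) = 0`, a nonzero `μ` first kills `∂ᵥf` and then all of `df`.
    have f1 : pderiv 1 f q = 0 := by simpa [duForm, hμ] using dN 1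
    obtain ⟨a, ha⟩ := hne
    exact ha (by simpa [f1, hμ] using dN a)
  exact ⟨hμ, by simpa [hμ, duForm] using dN 0⟩

/-- The case split on `∂ᵥf` is made at the single point `p`, so in the vanishing case derivatives of
`∂ᵥf` are not zero for free: they are read off from the Hessian equation. -/
theorem pderiv_transverseLaplacian_eq_zero (hV : IsOpen V) (hH : IsPPProfileOn H V)
    (hf : ContDiffOn ℝ ∞ f V)
    (hl : ∀ q ∈ V, IsLightlike (ppMetric H) q (gradient (ppMetric H) f q))
    (hE : IsEinsteinOn (conformal f (ppMetric H)) V) {p : Coord} (hp : p ∈ V) {i : Fin 4}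
    (hi : i = 2 ∨ i = 3) : pderiv i (transverseLaplacian H) p = 0 := by
  simp only [isLightlike_gradient_ppMetric_iff] at hl
  have hN := fun q hq => (hl q hq).2
  obtain ⟨μ, hμ⟩ := exists_hessian_eq hV hH hf hN hE
  have hz := fun q hq => hessian_trace_eq_zero hV hH hf hN hq (hl q hq).1 (hμ q hq)
  have hHess : ∀ q ∈ V, ∀ i j, pderiv i (pderiv j f) q =
      (1 / 2) * transverseLaplacian H q * (duForm i * duForm j)
      + (1 / 2) * (pderiv 1 f q * (pderiv i H q * duForm j + pderiv j H q * duForm i)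
        - (pderiv 0 H q * pderiv 1 f q + pderiv 2 H q * pderiv 2 f q
          + pderiv 3 H q * pderiv 3 f q) * (duForm i * duForm j))
      - (1 / 2) * (pderiv i f q * pderiv j f q) := fun q hq i j => by
    rw [hμ q hq, (hz q hq).1]; ring
  have dL : DifferentiableAt ℝ (transverseLaplacian H) p :=
    differentiableAt_of_contDiffOn (contDiffOn_transverseLaplacian hH.smooth hV) hV hp
  have sf : ∀ a, ContDiffOn ℝ ∞ (pderiv a f) V := contDiffOn_pderiv hf hV
  have df : ∀ a, DifferentiableAt ℝ (pderiv a f) p := fun a =>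
    differentiableAt_of_contDiffOn (sf a) hV hp
  have dH : ∀ a, DifferentiableAt ℝ (pderiv a H) p := fun a =>
    differentiableAt_of_contDiffOn (contDiffOn_pderiv hH.smooth hV a) hV hp
  have di0 : duForm i = 0 := by rcases hi with rfl | rfl <;> rfl
  by_cases h1 : pderiv 1 f p = 0
  · have hN' := hN p hp
    -- With `∂ᵥf = 0` the null condition is a vanishing sum of squares of transverse derivatives.
    have h2 : pderiv 2 f p = 0 := by
      rw [h1] at hN'; nlinarith [sq_nonneg (pderiv 2 f p), sq_nonneg (pderiv 3 f p)]
    have h3 : pderiv 3 f p = 0 := by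
      rw [h1] at hN'; nlinarith [sq_nonneg (pderiv 2 f p), sq_nonneg (pderiv 3 f p)]
    have hfi : pderiv i f p = 0 := by rcases hi with rfl | rfl <;> assumption
    have fi : ∀ j, pderiv i (pderiv j f) p = 0 := fun j => by
      rw [hHess p hp]; simp [di0, h1, hfi]
    have f01 : pderiv 0 (pderiv 1 f) p = 0 := by
      rw [hHess p hp]; simp [h1, duForm]
    -- the `∂ᵤ`-derivative of the mixed equation
    have e1 : pderiv i (pderiv 0 (pderiv 0 f)) p = 0 := by
      rw [pderiv_comm (sf 0) hV hp]
      have dHi := dH i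
      have df1 := df 1
      have dfi := df i
      have df0 := df 0
      have : ∀ q ∈ V, pderiv i (pderiv 0 f) q
          = (1 / 2) * (pderiv 1 f q * pderiv i H q) - (1 / 2) * (pderiv i f q * pderiv 0 f q) := by
        intro q hq
        rw [hHess q hq]; simp [di0, duForm_zero]
      rw [pderiv_congr hV this hp, pderiv_sub 0 (by fun_prop) (by fun_prop),
        pderiv_const_mul 0 _ (by fun_prop), pderiv_const_mul 0 _ (by fun_prop),
        pderiv_mul 0 df1 dHi, pderiv_mul 0 dfi df0, f01, h1, hfi, pderiv_comm hf hV hp, fi]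
      ring
    have dH0 := dH 0
    have dH2 := dH 2
    have dH3 := dH 3
    have df0 := df 0
    have df1 := df 1
    have df2 := df 2
    have df3 := df 3
    -- Applying `∂ᵢ` to the `(u,u)` equation gives `½ ∂ᵢL` at `p`: every other term has a factor
    -- `∂ⱼf` with `j ≠ 0` or `∂ᵢ∂ⱼf`, all zero there. By `e1` the left side is zero too.
    have : ∀ q ∈ V, pderiv 0 (pderiv 0 f) q = (1 / 2) * transverseLaplacian H q
          + (1 / 2) * (pderiv 0 H q * pderiv 1 f q - pderiv 2 H q * pderiv 2 f q
            - pderiv 3 H q * pderiv 3 f q) - (1 / 2) * pderiv 0 f q ^ 2 := by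
      intro q hq
      rw [hHess q hq]; simp [duForm]; ring
    rw [pderiv_congr hV this hp, pderiv_sub i (by fun_prop) (by fun_prop),
      pderiv_add i (by fun_prop) (by fun_prop),
      pderiv_const_mul i _ (by fun_prop), pderiv_const_mul i _ (by fun_prop),
      pderiv_const_mul i _ (by fun_prop), pderiv_sub i (by fun_prop) (by fun_prop),
      pderiv_sub i (by fun_prop) (by fun_prop), pderiv_mul i dH0 df1, pderiv_mul i dH2 df2,
      pderiv_mul i dH3 df3, pderiv_sq i df0, fi, fi, fi, fi, h1, h2, h3] at e1
    linear_combination 2 * e1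
  -- Here `L ∂ᵥf = 0` gives `L = 0` at `p`, and differentiating the same identity leaves `∂ᵢL ∂ᵥf =
  -- 0`.
  · have hL : transverseLaplacian H p = 0 := by simpa [h1] using (hz p hp).2
    have e := pderiv_eq_zero hV (fun q hq => (hz q hq).2) hp i
    rw [pderiv_mul i dL (df 1), hL] at e
    simpa [h1] using e

end

/-! ### Sufficiency: an ODE in `u` and the resulting conformal factor. -/

/-- Local smooth solutions of `F'' = h / 2 - F'² / 2` with nonvanishing derivative. -/
theorem exists_local_solution {h : ℝ → ℝ} {t₀ δ : ℝ} (hδ : 0 < δ)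
    (hh : ContDiffOn ℝ ∞ h (Set.Ioo (t₀ - δ) (t₀ + δ))) :
    ∃ ε > 0, ε ≤ δ ∧ ∃ F w : ℝ → ℝ, ContDiffOn ℝ ∞ F (Set.Ioo (t₀ - ε) (t₀ + ε)) ∧
      ∀ t ∈ Set.Ioo (t₀ - ε) (t₀ + ε), HasDerivAt F (w t) t ∧
        HasDerivAt w (h t / 2 - w t ^ 2 / 2) t ∧ w t ≠ 0 := by
  have hmem : Set.Ioo (t₀ - δ) (t₀ + δ) ∈ 𝓝 t₀ := Ioo_mem_nhds (by linarith) (by linarith)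
  have hc : ContDiffAt ℝ 1 h t₀ := (hh.contDiffAt hmem).of_le (by simp)
  -- The state is `(t, F, F')`: time is adjoined to make the system autonomous. The initial value
  -- `F' = 1` keeps `F'` nonzero nearby.
  let X : ℝ × ℝ × ℝ → ℝ × ℝ × ℝ := fun z => (1, z.2.2, h z.1 / 2 - z.2.2 ^ 2 / 2)
  have hX : ContDiffAt ℝ 1 X (t₀, 0, 1) := by
    have h1 : ContDiffAt ℝ 1 (fun z : ℝ × ℝ × ℝ => h z.1) (t₀, 0, 1) :=
      ContDiffAt.comp (t₀, 0, 1) (g := h) hc contDiffAt_fst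
    exact contDiffAt_const.prodMk ((by fun_prop : ContDiffAt ℝ 1
      (fun z : ℝ × ℝ × ℝ => z.2.2) (t₀, 0, 1)).prodMk (by fun_prop))
  obtain ⟨α, hα0, ε₁, hε₁, hα⟩ :=
    hX.exists_forall_mem_closedBall_exists_eq_forall_mem_Ioo_hasDerivAt₀ t₀
  have d1 : ∀ t ∈ Set.Ioo (t₀ - ε₁) (t₀ + ε₁), HasDerivAt (fun s => (α s).1) 1 t :=
    fun t ht => (hα t ht).fst
  have d2 : ∀ t ∈ Set.Ioo (t₀ - ε₁) (t₀ + ε₁), HasDerivAt (fun s => (α s).2.1) (α t).2.2 t :=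
    fun t ht => (hα t ht).snd.fst
  have d3 : ∀ t ∈ Set.Ioo (t₀ - ε₁) (t₀ + ε₁),
      HasDerivAt (fun s => (α s).2.2) (h (α t).1 / 2 - (α t).2.2 ^ 2 / 2) t :=
    fun t ht => (hα t ht).snd.snd
  have ht₀ : t₀ ∈ Set.Ioo (t₀ - ε₁) (t₀ + ε₁) := ⟨by linarith, by linarith⟩
  have hα1 : ∀ t ∈ Set.Ioo (t₀ - ε₁) (t₀ + ε₁), (α t).1 = t := by
    intro t ht
    have hd : ∀ s ∈ Set.Ioo (t₀ - ε₁) (t₀ + ε₁), HasDerivAt (fun s => (α s).1 - s) 0 s :=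
      fun s hs => by simpa using (d1 s hs).fun_sub (hasDerivAt_id' s)
    have := isOpen_Ioo.is_const_of_deriv_eq_zero isPreconnected_Ioo
      (fun s hs => (hd s hs).differentiableAt.differentiableWithinAt)
      (fun s hs => (hd s hs).deriv) ht ht₀
    simp only [hα0] at this
    linarith
  have hw0 : ∀ᶠ t in 𝓝 t₀, (α t).2.2 ≠ 0 :=
    (d3 t₀ ht₀).continuousAt.eventually_ne (by simp [hα0])
  obtain ⟨ε₂, hε₂, hw⟩ := Metric.eventually_nhds_iff.1 hw0
  refine ⟨min δ (min ε₁ ε₂), lt_min hδ (lt_min hε₁ hε₂), min_le_left _ _,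
    fun s => (α s).2.1, fun s => (α s).2.2, ?_⟩
  set ε := min δ (min ε₁ ε₂)
  have e1 : ε ≤ ε₁ := (min_le_right _ _).trans (min_le_left _ _)
  have e2 : ε ≤ ε₂ := (min_le_right _ _).trans (min_le_right _ _)
  have eδ : ε ≤ δ := min_le_left _ _
  have sub1 : Set.Ioo (t₀ - ε) (t₀ + ε) ⊆ Set.Ioo (t₀ - ε₁) (t₀ + ε₁) :=
    Set.Ioo_subset_Ioo (by linarith) (by linarith)
  have subδ : Set.Ioo (t₀ - ε) (t₀ + ε) ⊆ Set.Ioo (t₀ - δ) (t₀ + δ) :=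
    Set.Ioo_subset_Ioo (by linarith) (by linarith)
  have d3' : ∀ t ∈ Set.Ioo (t₀ - ε) (t₀ + ε),
      HasDerivAt (fun s => (α s).2.2) (h t / 2 - (α t).2.2 ^ 2 / 2) t := fun t ht => by
    simpa [hα1 t (sub1 ht)] using d3 t (sub1 ht)
  -- Bootstrap: the equation expresses `w'` through `h` and `w`, so each order of smoothness of `w`
  -- yields the next.
  have hwn : ∀ n : ℕ, ContDiffOn ℝ n (fun s => (α s).2.2) (Set.Ioo (t₀ - ε) (t₀ + ε)) := by
    intro n
    induction n with
    | zero =>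
      exact contDiffOn_zero.2 fun t ht => (d3' t ht).continuousAt.continuousWithinAt
    | succ n ih =>
      push_cast
      rw [contDiffOn_succ_iff_deriv_of_isOpen isOpen_Ioo]
      refine ⟨fun t ht => (d3' t ht).differentiableAt.differentiableWithinAt, by simp, ?_⟩
      refine ContDiffOn.congr (f := fun t => h t / 2 - (α t).2.2 ^ 2 / 2) ?_
        fun t ht => (d3' t ht).deriv
      exact (((hh.mono subδ).of_le (by exact_mod_cast le_top)).div_const 2).sub
        ((ih.pow 2).div_const 2)
  refine ⟨?_, fun t ht => ⟨d2 t (sub1 ht), d3' t ht, hw ?_⟩⟩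
  · rw [contDiffOn_infty_iff_deriv_of_isOpen isOpen_Ioo]
    exact ⟨fun t ht => (d2 t (sub1 ht)).differentiableAt.differentiableWithinAt,
      (contDiffOn_infty.2 hwn).congr fun t ht => (d2 t (sub1 ht)).deriv⟩
  · rw [Real.dist_eq, abs_lt]
    constructor <;> linarith [ht.1, ht.2]

theorem fderiv_apply_eq_sum_pderiv (F : Coord → ℝ) (p x : Coord) :
    fderiv ℝ F p x = ∑ i, x i * pderiv i F p := by
  have hx : x = ∑ i, x i • (Pi.single i 1 : Coord) := by
    funext j
    simp [Finset.sum_apply, Pi.single_apply]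
  conv_lhs => rw [hx]
  simp [pderiv]

/-- By the mean value theorem on the segment from `x` to `y`, whose direction has no `u`-component.
-/
theorem eq_of_pderiv_eq_zero {L : Coord → ℝ} {s : Set Coord} (hs : IsOpen s) (hc : Convex ℝ s)
    (hL : DifferentiableOn ℝ L s) (h : ∀ q ∈ s, ∀ i, i ≠ 0 → pderiv i L q = 0) {x y : Coord}
    (hx : x ∈ s) (hy : y ∈ s) (hxy : x 0 = y 0) : L x = L y := by
  obtain ⟨z, hz, e⟩ := domain_mvt (f' := fun z => fderiv ℝ L z)
    (fun z hz => (hL.differentiableAt (hs.mem_nhds hz)).hasFDerivAt.hasFDerivWithinAt) hc hx hy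
  have hz' := h z (hc.segment_subset hx hy hz)
  rw [fderiv_apply_eq_sum_pderiv, Fin.sum_univ_four, hz' 1 (by simp), hz' 2 (by simp),
    hz' 3 (by simp)] at e
  simp [hxy] at e
  linarith

theorem pderiv_comp_zero {F : ℝ → ℝ} {w : ℝ} {p : Coord} (hF : HasDerivAt F w (p 0)) (i : Fin 4) :
    pderiv i (fun q => F (q 0)) p = duForm i * w := by
  have : HasFDerivAt (fun q : Coord => F (q 0))
      (w • ContinuousLinearMap.proj (R := ℝ) (φ := fun _ : Fin 4 => ℝ) 0) p :=
    HasDerivAt.comp_hasFDerivAt (f := fun q : Coord => q 0) p hF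
      (ContinuousLinearMap.proj (R := ℝ) (φ := fun _ : Fin 4 => ℝ) 0).hasFDerivAt
  rw [pderiv, this.fderiv]
  fin_cases i <;> simp [duForm]

theorem mem_Ioo_of_mem_ball {p q : Coord} {r : ℝ} (hq : q ∈ Metric.ball p r) :
    q 0 ∈ Set.Ioo (p 0 - r) (p 0 + r) := by
  rw [← Real.ball_eq_Ioo]
  exact lt_of_le_of_lt (dist_le_pi_dist q p 0) hq

/-- Balls of the sup norm are boxes, so the `u`-coordinate of the centre can be moved freely within
the radius. -/
theorem update_mem_ball {p : Coord} {t r : ℝ} (ht : t ∈ Set.Ioo (p 0 - r) (p 0 + r)) :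
    Function.update p 0 t ∈ Metric.ball p r := by
  rw [← Real.ball_eq_Ioo] at ht
  have hr : 0 < r := Metric.pos_of_mem_ball ht
  rw [Metric.mem_ball, dist_pi_lt_iff hr]
  intro i
  by_cases hi : i = 0
  · subst hi; simpa using ht
  · simpa [hi] using hr

theorem isIsotropicallyConformallyEinsteinOn_of_pderiv_eq_zero {H : Coord → ℝ} {U : Set Coord}
    (hU : IsOpen U) (hH : IsPPProfileOn H U)
    (h : ∀ p ∈ U, pderiv 2 (transverseLaplacian H) p = 0 ∧ pderiv 3 (transverseLaplacian H) p = 0) :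
    IsIsotropicallyConformallyEinsteinOn (ppMetric H) U := by
  intro p hp
  obtain ⟨δ, hδ, hball⟩ := Metric.isOpen_iff.1 hU p hp
  have hL := contDiffOn_transverseLaplacian hH.smooth hU
  have hsm : ContDiffOn ℝ ∞ (fun t => transverseLaplacian H (Function.update p 0 t))
      (Set.Ioo (p 0 - δ) (p 0 + δ)) :=
    hL.comp (contDiff_update ∞ p 0).contDiffOn fun t ht => hball (update_mem_ball ht)
  obtain ⟨ε, hε, hεδ, F, w, hF, hFw⟩ := exists_local_solution hδ hsm
  have hVU : Metric.ball p ε ⊆ U := (Metric.ball_subset_ball hεδ).trans hball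
  have hV : IsOpen (Metric.ball p ε) := Metric.isOpen_ball
  -- On the convex ball `L` is a function of `u` alone, equal to its restriction to the `u`-line
  -- through `p`, which is the source term of the ODE.
  have hLV : ∀ q ∈ Metric.ball p ε,
      transverseLaplacian H (Function.update p 0 (q 0)) = transverseLaplacian H q := by
    intro q hq
    refine eq_of_pderiv_eq_zero hV (convex_ball p ε)
      ((hL.mono hVU).differentiableOn (by simp)) (fun z hz i hi => ?_)
      (update_mem_ball (mem_Ioo_of_mem_ball hq)) hq (by simp)
    have h1 := hH.pderiv_one_transverseLaplacian hU (hVU hz)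
    obtain ⟨h2, h3⟩ := h z (hVU hz)
    fin_cases i
    · exact absurd rfl hi
    · exact h1
    · exact h2
    · exact h3
  have hf : ContDiffOn ℝ ∞ (fun q : Coord => F (q 0)) (Metric.ball p ε) :=
    hF.comp (contDiff_apply ℝ ℝ (0 : Fin 4)).contDiffOn fun q hq => mem_Ioo_of_mem_ball hq
  have hf1 : ∀ i, ∀ q ∈ Metric.ball p ε, pderiv i (fun q : Coord => F (q 0)) q
      = duForm i * w (q 0) := fun i q hq =>
    pderiv_comp_zero (hFw _ (mem_Ioo_of_mem_ball hq)).1 i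
  have hf2 : ∀ i j, ∀ q ∈ Metric.ball p ε, pderiv i (pderiv j (fun q : Coord => F (q 0))) q
      = duForm j * (duForm i * (transverseLaplacian H q / 2 - w (q 0) ^ 2 / 2)) := by
    intro i j q hq
    have hd := (hFw _ (mem_Ioo_of_mem_ball hq)).2.1
    rw [pderiv_congr hV (hf1 j) hq, pderiv_const_mul, pderiv_comp_zero hd, hLV q hq]
    exact DifferentiableAt.comp (f := fun q : Coord => q 0) q hd.differentiableAt (by fun_prop)
  -- The Einstein constant is `0`: the rescaled metric is Ricci-flat.
  refine ⟨Metric.ball p ε, hV, Metric.mem_ball_self hε, hVU, fun q => F (q 0), hf,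
    fun q hq => ?_, 0, fun q hq i j => ?_⟩
  · rw [isLightlike_gradient_ppMetric_iff]
    refine ⟨⟨0, ?_⟩, ?_⟩
    · simpa [hf1 _ q hq, duForm_zero] using (hFw _ (mem_Ioo_of_mem_ball hq)).2.2
    · simp [hf1 _ q hq, duForm_one, duForm_two, duForm_three]
  · rw [ricci_conformal hV (hH.mono hVU) hf hq]
    simp only [hf1 _ q hq, hf2 _ _ q hq, duForm_zero, duForm_one, duForm_two, duForm_three]
    rw [transverseLaplacian]
    ring

end PPWave

end

theorem mainTheorem4 (U : Set PPWave.Coord) (hU : IsOpen U) (H : PPWave.Coord → ℝ)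
    (hH : PPWave.IsPPProfileOn H U) :
    PPWave.IsIsotropicallyConformallyEinsteinOn (PPWave.ppMetric H) U ↔
      PPWave.HasHarmonicWeylOn (PPWave.ppMetric H) U := by
  rw [PPWave.hasHarmonicWeylOn_ppMetric_iff hU hH]
  refine ⟨fun h p hp => ?_, PPWave.isIsotropicallyConformallyEinsteinOn_of_pderiv_eq_zero hU hH⟩
  obtain ⟨V, hV, hpV, hVU, f, hf, hl, hE⟩ := h p hp
  have key := fun i (hi : i = 2 ∨ i = 3) =>
    PPWave.pderiv_transverseLaplacian_eq_zero hV (hH.mono hVU) hf hl hE hpV (i := i) hi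
  exact ⟨key 2 (Or.inl rfl), key 3 (Or.inr rfl)⟩
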